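/- Let $C_b(\mathbb R,\mathbb C)$ be the algebra of bounded continuous functions $\mathbb R\to\mathbb C$ with the supremum norm $\|\cdot\|_\infty$, and let $\mathrm{AP}\subseteq C_b(\mathbb R,\mathbb C)$ be the algebra of almost periodic functions, i.e. the uniform closure of the set of all functions $t\mapsto\sum_{j=1}^n a_je^{i\mu_jt}$ with $n\in\mathbb N$, $a_j\in\mathbb C$, $\mu_j\in\mathbb R$. For a commutative unital ring $R$ and $n\ge 1$, let $U_n(R)$ be the set of invertible $n$-tuples, i.e. of all $(f_1,\dots,f_n)\in R^n$ for which there is $(x_1,\dots,x_n)\in R^n$ with $\sum_{j=1}^n x_jf_j=1$. A tuple $(f_1,\dots,f_n,g)\in U_{n+1}(R)$ is reducible if there is $(a_1,\dots,a_n)\in R^n$ with $(f_1+a_1g,\dots,f_n+a_ng)\in U_n(R)$. The Bass stable rank of $R$ is the least integer $n\ge1$ such that every element of $U_{n+1}(R)$ is reducible, and it is $\infty$ if no such $n$ exists. **Theorem.** Let $\Lambda=\{\lambda_1,\lambda_2,\dots\}$ be a countably infinite subset of $\mathbb R$, with the $\lambda_k$ pairwise distinct, that is linearly independent over $\mathbb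 Q$. For $j=1,2,\dots$ put $$F_j(t)=e^{i\lambda_{2j-1}t}+e^{i\lambda_{2j}t}-1,\qquad t\in\mathbb R.$$ Then $F_j\in\mathrm{AP}$ for every $j\ge 1$. Moreover, let $A$ be any complex subalgebra of $\mathrm{AP}$ (not necessarily closed) that contains the constant function $1$ and all the functions $F_j$, $j\ge1$. Then: 1. the Bass stable rank of $A$ is infinite; 2. for every $N\ge1$ the tuple $(F_1,\dots,F_N)$ cannot be approximated in the supremum norm by tuples that are invertible in $A$: there is $\varepsilon>0$ such that every $(H_1,\dots,H_N)\in U_N(A)$ satisfies $\max_{1\le j\le N}\|F_j-H_j\|_\infty\ge\varepsilon$. -/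

import Mathlib

open scoped BoundedContinuousFunction

noncomputable section

/-- The function `t ↦ e^{iμt}` as an element of `C_b(ℝ, ℂ)`. -/
def expChar (μ : ℝ) : ℝ →ᵇ ℂ :=
  BoundedContinuousFunction.ofNormedAddCommGroup
    (fun t : ℝ => Complex.exp (Complex.I * (μ : ℂ) * (t : ℂ)))
    (by fun_prop) 1
    (fun t => by
      have h : Complex.I * (μ : ℂ) * (t : ℂ) = ((μ * t : ℝ) : ℂ) * Complex.I := by
        push_cast; ring
      rw [h, Complex.norm_exp_ofReal_mul_I])

/-- Generalized trigonometric polynomials `Q(t) = ∑_{j=1}^n a_j e^{i μ_j t}`. -/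
def genTrigPolys : Set (ℝ →ᵇ ℂ) :=
  {Q | ∃ (n : ℕ) (a : Fin n → ℂ) (μ : Fin n → ℝ), Q = ∑ j, a j • expChar (μ j)}

/-- The set `AP` of almost periodic functions on `ℝ`: the closure, in the sup norm of
`C_b(ℝ, ℂ)`, of the set of generalized trigonometric polynomials. -/
def AP : Set (ℝ →ᵇ ℂ) := closure genTrigPolys

/-- An `n`-tuple in a commutative ring is invertible (unimodular) if it satisfies a Bézout
equation `∑ x_j f_j = 1`. -/
def IsInvertibleTuple {R : Type*} [CommRing R] {n : ℕ} (f : Fin n → R) : Prop :=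
  ∃ x : Fin n → R, ∑ j, x j * f j = 1

/-- An `(n+1)`-tuple `(f_1, …, f_n, g)` is reducible if `(f_1 + a_1 g, …, f_n + a_n g)` is
invertible for some `a_1, …, a_n` in the ring. -/
def IsReducibleTuple {R : Type*} [CommRing R] {n : ℕ} (f : Fin (n + 1) → R) : Prop :=
  ∃ a : Fin n → R,
    IsInvertibleTuple (fun j : Fin n => f j.castSucc + a j * f (Fin.last n))

/-- The Bass stable rank: the least `n ≥ 1` such that every invertible `(n+1)`-tuple is
reducible, and `⊤` if there is no such `n`. -/
def bassStableRank (R : Type*) [CommRing R] : ℕ∞ :=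
  ⨅ n ∈ {n : ℕ | 1 ≤ n ∧ ∀ f : Fin (n + 1) → R, IsInvertibleTuple f → IsReducibleTuple f},
    (n : ℕ∞)

/-- The functions `F_j(t) = e^{iλ_{2j-1}t} + e^{iλ_{2j}t} - 1`, `j = 1, 2, …`, numbered from `0`:
with `lam k = λ_{k+1}`, `pairFun lam j` is `F_{j+1}`. -/
def pairFun (lam : ℕ → ℝ) (j : ℕ) : ℝ →ᵇ ℂ :=
  expChar (lam (2 * j)) + expChar (lam (2 * j + 1)) - 1

end

/-! A continuous family of unitary characters of the discrete group `ℝ`, indexed by `X`, induces a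
contractive unital homomorphism from `AP` to `X →ᵇ ℂ`. Rational independence lets the angles of the
`e^{iλ_k t}` be prescribed as arbitrary continuous functions on `X`. Since `1 + c` with `‖c‖ ≤ 1/2`
is a sum of two unimodular numbers, the `F_j` can be sent to any continuous functions bounded by
`1/2` (`exists_twistGraph_pairFun`). Take `X = ℂ^N` and send `F_1, …, F_N` to the coordinates and
the next `N` functions to their conjugates, near the origin. Bézout equations survive the
homomorphism, so an invertible tuple has an image without common zeros
(`IsInvertibleTuple.exists_apply_ne_zero`). But a tuple close to `F`, or one reducing `(F, 1 - 4 ∑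
F_{N+j} F_j)`, becomes a perturbation of the identity that has a zero by Brouwer's theorem. -/

/-! ### Brouwer's theorem by the volume-polynomial argument -/

open Metric MeasureTheory in
theorem LipschitzOnWith.lipschitzWith_of_eq_zero {E F : Type*} [NormedAddCommGroup E]
    [NormedSpace ℝ E] [NormedAddCommGroup F] {v : E → F} {ρ : ℝ} {K : NNReal}
    (hv : LipschitzOnWith K v (closedBall 0 ρ)) (h0 : ∀ x, ρ ≤ ‖x‖ → v x = 0) :
    LipschitzWith K v := by
  have key : ∀ x y : E, ‖x‖ ≤ ρ → ρ ≤ ‖y‖ → dist (v x) (v y) ≤ K * dist x y := by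
    intro x y hx hy
    have hconn : IsPreconnected (segment ℝ x y) := (convex_segment x y).isPreconnected
    obtain ⟨z, hz, hzρ⟩ := hconn.intermediate_value (left_mem_segment ℝ x y)
      (right_mem_segment ℝ x y) continuous_norm.continuousOn ⟨hx, hy⟩
    have hzρ : ‖z‖ = ρ := hzρ
    rw [h0 y hy, ← h0 z hzρ.ge]
    refine (hv.dist_le_mul x (by simpa using hx) z (by simpa using hzρ.le)).trans ?_
    gcongr
    have := dist_add_dist_of_mem_segment hz
    linarith [dist_nonneg (x := z) (y := y)]
  refine LipschitzWith.of_dist_le_mul fun x y => ?_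
  rcases le_total ‖x‖ ρ with hx | hx <;> rcases le_total ‖y‖ ρ with hy | hy
  · exact hv.dist_le_mul x (by simpa using hx) y (by simpa using hy)
  · exact key x y hx hy
  · rw [dist_comm, dist_comm x]; exact key y x hy hx
  · rw [h0 x hx, h0 y hy, dist_self]; positivity

theorem LipschitzWith.bijective_id_add {E : Type*} [NormedAddCommGroup E]
    [NormedSpace ℝ E] [CompleteSpace E] {v : E → E} {K : NNReal}
    (hv : LipschitzWith K v) (hK : K < 1) : Function.Bijective (fun x => x + v x) := by
  have happ : ApproximatesLinearOn (fun x => x + v x)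
      ((ContinuousLinearEquiv.refl ℝ E : E ≃L[ℝ] E) : E →L[ℝ] E) Set.univ K := by
    rw [ApproximatesLinearOn.approximatesLinearOn_iff_lipschitzOnWith]
    convert hv.lipschitzOnWith (s := Set.univ) using 1
    ext x
    simp
  have hc : Subsingleton E ∨
      K < ‖((ContinuousLinearEquiv.refl ℝ E).symm : E →L[ℝ] E)‖₊⁻¹ := by
    rcases subsingleton_or_nontrivial E with h | h
    · exact Or.inl h
    · right
      have : ‖((ContinuousLinearEquiv.refl ℝ E).symm : E →L[ℝ] E)‖₊ = 1 := by
        rw [← NNReal.coe_inj]; simp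
      rw [this]; simpa using hK
  exact ⟨Set.injOn_univ.mp (happ.injOn hc), happ.surjective hc⟩

theorem image_eq_of_bijective_of_forall_notMem {α : Type*} {g : α → α} {s : Set α}
    (hg : Function.Bijective g) (h : ∀ x, x ∉ s → g x = x) : g '' s = s := by
  ext y
  constructor
  · rintro ⟨x, hx, rfl⟩
    by_contra hy
    exact hy ((hg.1 (h _ hy)).symm ▸ hx)
  · intro hy
    obtain ⟨x, rfl⟩ := hg.2 y
    by_cases hx : x ∈ s
    · exact ⟨x, hx, rfl⟩
    · exact absurd (h x hx ▸ hy) hx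

-- `det (1 + tA)` is a polynomial in `t` of degree at most the dimension. Interpolation transports
-- identities known for small `t` to `t = 1`.
open Polynomial in
theorem ContinuousLinearMap.det_one_add_eq_sum {E : Type*} [NormedAddCommGroup E]
    [NormedSpace ℝ E] [FiniteDimensional ℝ E] {τ : ℕ → ℝ} (hτ : Function.Injective τ)
    (A : E →L[ℝ] E) :
    (1 + A).det = ∑ i ∈ Finset.range (Module.finrank ℝ E + 1),
      (Lagrange.basis (Finset.range (Module.finrank ℝ E + 1)) τ i).eval 1 * (1 + τ i • A).det := by
  classical
  let b := Module.finBasis ℝ E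
  let M := LinearMap.toMatrix b b (A : E →ₗ[ℝ] E)
  let p : ℝ[X] := Matrix.det ((X : ℝ[X]) • M.map C + (1 : Matrix _ _ ℝ).map C)
  have hdeg : p.degree < (Finset.range (Module.finrank ℝ E + 1)).card := by
    rw [Finset.card_range]
    refine lt_of_le_of_lt degree_le_natDegree ?_
    have := natDegree_det_X_add_C_le M 1
    rw [Fintype.card_fin] at this
    exact_mod_cast Nat.lt_succ_of_le this
  have hev : ∀ t : ℝ, p.eval t = (1 + t • A).det := by
    intro t
    have h1 : p.eval t = Matrix.det (1 + t • M) := by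
      rw [← coe_evalRingHom, RingHom.map_det]
      congr 1
      ext i j
      by_cases h : i = j <;> simp [h] <;> ring
    rw [h1, ContinuousLinearMap.det, ← LinearMap.det_toMatrix b]
    congr 1
    simp [M, Module.End.one_eq_id]
  have := congrArg (eval 1) (Lagrange.eq_interpolate (s := Finset.range (Module.finrank ℝ E + 1))
    hτ.injOn hdeg)
  rw [hev, one_smul, Lagrange.interpolate_apply, eval_finsetSum] at this
  rw [this]
  refine Finset.sum_congr rfl fun i _ => ?_
  rw [eval_mul, eval_C, hev, mul_comm]

/-- Differentiating `‖r‖² = ρ²` shows that the range of the derivative is orthogonal to `r x ≠ 0`.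
-/
theorem det_fderiv_eq_zero_of_norm_eq {E : Type*} [NormedAddCommGroup E]
    [InnerProductSpace ℝ E] [FiniteDimensional ℝ E] {r : E → E} (hr : Differentiable ℝ r)
    {ρ : ℝ} (hρ : 0 < ρ) (hn : ∀ x, ‖r x‖ = ρ) (x : E) : (fderiv ℝ r x).det = 0 := by
  by_contra hdet
  have hsurj : Function.Surjective (fderiv ℝ r x : E →ₗ[ℝ] E) := by
    exact (LinearMap.equivOfDetNeZero _ hdet).surjective
  obtain ⟨v, hv⟩ := hsurj (r x)
  have h1 : HasFDerivAt (fun y => ‖r y‖ ^ 2) _ x := (hr x).hasFDerivAt.norm_sq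
  have h2 : (fun y => ‖r y‖ ^ 2) = fun _ => ρ ^ 2 := by ext y; rw [hn]
  rw [h2] at h1
  have h3 := DFunLike.congr_fun (h1.unique (hasFDerivAt_const _ _)) v
  have hv' : fderiv ℝ r x v = r x := hv
  simp [hv', hn, hρ.ne'] at h3

-- For small `t` the map `x + t w x`, extended by the identity, permutes the ball and has positive
-- Jacobian, so the integral is the volume of the image.
open Metric MeasureTheory in
theorem exists_setIntegral_det_eq {E : Type*} [NormedAddCommGroup E]
    [NormedSpace ℝ E] [FiniteDimensional ℝ E] [MeasurableSpace E] [BorelSpace E]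
    (μ : Measure E) [μ.IsAddHaarMeasure]
    {w : E → E} (hw : ContDiff ℝ 1 w) {ρ : ℝ} (h0 : ∀ x, ‖x‖ = ρ → w x = 0) :
    ∃ t₀ : ℝ, 0 < t₀ ∧ ∀ t, 0 < t → t ≤ t₀ →
      ∫ x in closedBall (0 : E) ρ, (1 + t • fderiv ℝ w x).det ∂μ =
        μ.real (closedBall (0 : E) ρ) := by
  have : ProperSpace E := FiniteDimensional.proper ℝ E
  set B := closedBall (0 : E) ρ with hB
  have hBc : IsCompact B := isCompact_closedBall _ _
  obtain ⟨K, hK⟩ : ∃ K, LipschitzOnWith K w B :=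
    hw.locallyLipschitz.locallyLipschitzOn.exists_lipschitzOnWith_of_compact hBc
  have hDc : Continuous (fderiv ℝ w) := hw.continuous_fderiv (by simp)
  have hdetc : Continuous (fun A : E →L[ℝ] E => A.det) := ContinuousLinearMap.continuous_det
  obtain ⟨M, hM⟩ := hBc.exists_bound_of_continuousOn hDc.continuousOn
  obtain ⟨δ, hδ, hdet⟩ : ∃ δ > 0, ∀ A : E →L[ℝ] E, ‖A‖ < δ → 0 < (1 + A).det := by
    have hc : Continuous (fun A : E →L[ℝ] E => (1 + A).det) := hdetc.comp (by fun_prop)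
    have h1 : (0 : ℝ) < (1 + (0 : E →L[ℝ] E)).det := by simp [ContinuousLinearMap.det]
    obtain ⟨δ, hδ, h⟩ := Metric.eventually_nhds_iff.1 (hc.continuousAt.eventually (lt_mem_nhds h1))
    exact ⟨δ, hδ, fun A hA => h (by simpa using hA)⟩
  -- The first bound makes `t • w` a strict contraction on the ball; the second keeps the
  -- determinant positive.
  refine ⟨min (1 / (2 * (K + 1))) (δ / (2 * (|M| + 1))), by positivity, fun t ht htt => ?_⟩
  have htK : t * K < 1 := by
    have h1 : t * (2 * (K + 1)) ≤ 1 := by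
      rw [← le_div_iff₀ (by positivity)]; exact htt.trans (min_le_left _ _)
    nlinarith [K.2]
  have htM : t * |M| < δ := by
    have h1 : t * (2 * (|M| + 1)) ≤ δ := by
      rw [← le_div_iff₀ (by positivity)]; exact htt.trans (min_le_right _ _)
    nlinarith [abs_nonneg M]
  let v : E → E := fun x => if ‖x‖ ≤ ρ then t • w x else 0
  have hvB : ∀ x ∈ B, v x = t • w x := fun x hx => if_pos (by simpa [hB] using hx)
  have hvL : LipschitzWith (t.toNNReal * K) v := by
    refine LipschitzOnWith.lipschitzWith_of_eq_zero (ρ := ρ) ?_ ?_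
    · refine LipschitzOnWith.of_dist_le_mul fun x hx y hy => ?_
      rw [hvB x hx, hvB y hy, dist_smul₀, NNReal.coe_mul, mul_assoc, Real.norm_of_nonneg ht.le,
        Real.coe_toNNReal _ ht.le]
      gcongr
      exact hK.dist_le_mul x hx y hy
    · intro x hx
      by_cases h : ‖x‖ ≤ ρ
      · simp [v, h0 x (le_antisymm h hx)]
      · simp [v, h]
  have hbij : Function.Bijective (fun x => x + v x) := by
    refine hvL.bijective_id_add ?_
    rw [← NNReal.coe_lt_coe]
    simpa [ht.le] using htK
  have himg : (fun x => x + v x) '' B = B := by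
    refine image_eq_of_bijective_of_forall_notMem hbij fun x hx => ?_
    have : ¬ ‖x‖ ≤ ρ := by simpa [hB] using hx
    simp [v, this]
  have hder : ∀ x ∈ B, HasFDerivWithinAt (fun x => x + v x) (1 + t • fderiv ℝ w x) B x := by
    intro x hx
    have h1 : HasFDerivAt (fun x => x + t • w x) (1 + t • fderiv ℝ w x) x :=
      (hasFDerivAt_id x).add (((hw.differentiable (by simp)) x).hasFDerivAt.const_smul t)
    exact h1.hasFDerivWithinAt.congr (fun y hy => by rw [hvB y hy]) (by rw [hvB x hx])
  have hBm : MeasurableSet B := hBc.measurableSet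
  have hlin := lintegral_abs_det_fderiv_eq_addHaar_image μ hBm hder hbij.1.injOn
  rw [himg] at hlin
  have hpos : ∀ x ∈ B, 0 < (1 + t • fderiv ℝ w x).det := by
    intro x hx
    apply hdet
    rw [norm_smul, Real.norm_of_nonneg ht.le]
    refine lt_of_le_of_lt ?_ htM
    gcongr
    exact (hM x hx).trans (le_abs_self M)
  rw [integral_eq_lintegral_of_nonneg_ae]
  · rw [Measure.real, ← hlin]
    congr 1
    refine setLIntegral_congr_fun hBm fun x hx => ?_
    simp only [abs_of_pos (hpos x hx)]
  · filter_upwards [ae_restrict_mem hBm] with x hx using (hpos x hx).le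
  · refine Continuous.aestronglyMeasurable ?_
    exact hdetc.comp (by fun_prop)

-- Otherwise normalising `h` retracts the ball onto its sphere. The integrated Jacobian is then the
-- volume of the ball, by interpolation from small `t`, yet it vanishes pointwise.
open Metric MeasureTheory in
theorem exists_eq_zero_of_contDiff_of_eq_self {E : Type*} [NormedAddCommGroup E]
    [InnerProductSpace ℝ E] [FiniteDimensional ℝ E] {h : E → E} (hh : ContDiff ℝ 1 h)
    {ρ : ℝ} (hρ : 0 < ρ) (hid : ∀ x, ‖x‖ = ρ → h x = x) : ∃ x, h x = 0 := by
  by_contra! hne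
  borelize E
  let μ : Measure E := Measure.addHaar
  have : ProperSpace E := FiniteDimensional.proper ℝ E
  let r : E → E := fun x => (ρ * ‖h x‖⁻¹) • h x
  have hr : ContDiff ℝ 1 r :=
    (contDiff_const.mul ((hh.norm ℝ hne).inv fun x => norm_ne_zero_iff.2 (hne x))).smul hh
  have hrn : ∀ x, ‖r x‖ = ρ := by
    intro x
    have := norm_ne_zero_iff.2 (hne x)
    simp only [r, norm_smul, norm_mul, norm_inv, norm_norm, Real.norm_of_nonneg hρ.le]
    field_simp
  have hrid : ∀ x, ‖x‖ = ρ → r x - x = 0 := by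
    intro x hx
    simp [r, hid x hx, hx, hρ.ne']
  have hw : ContDiff ℝ 1 (fun x => r x - x) := hr.sub contDiff_id
  obtain ⟨t₀, ht₀, hint⟩ := exists_setIntegral_det_eq μ hw hrid
  let τ : ℕ → ℝ := fun i => t₀ / (i + 1)
  have hτ : Function.Injective τ := by
    intro i j hij
    have h1 : ((i : ℝ) + 1) = j + 1 := by
      have := hij
      simp only [τ] at this
      field_simp at this
      linarith
    exact_mod_cast add_right_cancel h1
  have hDc : Continuous (fderiv ℝ (fun x => r x - x)) := hw.continuous_fderiv (by simp)
  have hI : ∫ x in closedBall (0 : E) ρ, (1 + fderiv ℝ (fun x => r x - x) x).det ∂μ =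
      μ.real (closedBall (0 : E) ρ) := by
    have hsum := fun x =>
      ContinuousLinearMap.det_one_add_eq_sum hτ (fderiv ℝ (fun x => r x - x) x)
    simp only [hsum]
    rw [integral_finsetSum]
    · simp_rw [integral_const_mul]
      have : ∀ i ∈ Finset.range (Module.finrank ℝ E + 1),
          ∫ x in closedBall (0 : E) ρ, (1 + τ i • fderiv ℝ (fun x => r x - x) x).det ∂μ =
          μ.real (closedBall (0 : E) ρ) := by
        intro i _
        refine hint _ (by positivity) (div_le_self ht₀.le ?_)
        have : (0 : ℝ) ≤ i := i.cast_nonneg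
        linarith
      rw [Finset.sum_congr rfl fun i hi => by rw [this i hi], ← Finset.sum_mul,
        ← Polynomial.eval_finsetSum, Lagrange.sum_basis hτ.injOn (by simp)]
      simp
    · intro i _
      refine ContinuousOn.integrableOn_compact (isCompact_closedBall _ _) (Continuous.continuousOn ?_)
      refine continuous_const.mul (ContinuousLinearMap.continuous_det.comp ?_)
      fun_prop
  have hz : ∀ x, (1 + fderiv ℝ (fun x => r x - x) x).det = 0 := by
    intro x
    have h1 : fderiv ℝ (fun x => r x - x) x = fderiv ℝ r x - 1 :=
      (((hr.differentiable (by simp)) x).hasFDerivAt.sub (hasFDerivAt_id x)).fderiv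
    rw [h1, add_sub_cancel]
    exact det_fderiv_eq_zero_of_norm_eq (hr.differentiable (by simp)) hρ hrn x
  simp only [hz, integral_zero] at hI
  have : 0 < μ.real (closedBall (0 : E) ρ) :=
    ENNReal.toReal_pos (measure_closedBall_pos μ _ hρ).ne' measure_closedBall_lt_top.ne
  linarith

/-- A form of Brouwer's theorem: a compactly supported continuous perturbation of the identity
has a zero. -/
theorem exists_add_eq_zero_of_eq_zero_of_le_norm {E : Type*} [NormedAddCommGroup E]
    [InnerProductSpace ℝ E] [FiniteDimensional ℝ E] {w : E → E} (hw : Continuous w)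
    {R : ℝ} (hR : 0 < R) (h0 : ∀ x, R ≤ ‖x‖ → w x = 0) : ∃ x, x + w x = 0 := by
  by_contra! hne
  have hε : ∀ x, 0 < ‖x + w x‖ := fun x => norm_pos_iff.2 (hne x)
  -- With this error function the smoothing `x + g x` still has no zero, and the support condition
  -- keeps it the identity far out.
  obtain ⟨g, hg, hgw, hsupp⟩ := hw.exists_contDiff_approx 1
    (ε := fun x => ‖x + w x‖) (by fun_prop) hε
  obtain ⟨x, hx⟩ := exists_eq_zero_of_contDiff_of_eq_self (h := fun x => x + g x)
    (contDiff_id.add hg) hR (fun x hx => by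
      have : g x = 0 := by
        by_contra hgx
        exact hsupp hgx (h0 x hx.ge)
      simp [this])
  have := hgw x
  rw [eq_neg_of_add_eq_zero_right hx, dist_eq_norm, ← norm_neg] at this
  simp [add_comm] at this

/-! ### Characters are contractive on trigonometric polynomials -/

theorem expChar_apply (μ t : ℝ) : expChar μ t = Complex.exp (Complex.I * μ * t) := rfl

/-- The homomorphism `μ ↦ (t ↦ e^{iμt})`. -/
noncomputable def expCharHom : Multiplicative ℝ →* (ℝ →ᵇ ℂ) where
  toFun μ := expChar μ.toAdd
  map_one' := by ext t; simp [expChar_apply]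
  map_mul' a b := by
    ext t
    simp only [expChar_apply, BoundedContinuousFunction.mul_apply, ← Complex.exp_add, toAdd_mul]
    push_cast
    ring_nf

/-- Evaluation of a formal trigonometric polynomial as a bounded continuous function. -/
noncomputable def trigPoly : AddMonoidAlgebra ℂ ℝ →ₐ[ℂ] (ℝ →ᵇ ℂ) :=
  AddMonoidAlgebra.lift ℂ (ℝ →ᵇ ℂ) ℝ expCharHom

theorem trigPoly_eq_sum (q : AddMonoidAlgebra ℂ ℝ) :
    trigPoly q = ∑ μ ∈ q.coeff.support, q.coeff μ • expChar μ := by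
  rw [trigPoly, AddMonoidAlgebra.lift_apply]; rfl

theorem trigPoly_apply (q : AddMonoidAlgebra ℂ ℝ) (t : ℝ) :
    trigPoly q t = ∑ μ ∈ q.coeff.support, q.coeff μ * Complex.exp (Complex.I * μ * t) := by
  rw [trigPoly_eq_sum]
  simp [expChar_apply]

theorem trigPoly_single (μ : ℝ) (a : ℂ) :
    trigPoly (AddMonoidAlgebra.single μ a) = a • expChar μ := by
  rw [trigPoly, AddMonoidAlgebra.lift_single]; rfl

theorem norm_integral_exp_le {c : ℝ} (hc : c ≠ 0) (T : ℝ) :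
    ‖∫ t in (0 : ℝ)..T, Complex.exp (Complex.I * c * t)‖ ≤ 2 / |c| := by
  have hc' : Complex.I * c ≠ 0 := by simp [hc]
  rw [integral_exp_mul_complex hc', norm_div]
  have h1 : ‖Complex.I * (c : ℂ)‖ = |c| := by simp
  rw [h1]
  gcongr
  refine (norm_sub_le _ _).trans ?_
  have h2 : Complex.I * (c : ℂ) * T = ((c * T : ℝ) : ℂ) * Complex.I := by push_cast; ring
  rw [h2, Complex.norm_exp_ofReal_mul_I]
  norm_num

/-- The coefficient is the mean of `q(t) e^{-iνt}`: the other frequencies have integrals over `[0,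
T]` bounded independently of `T`. -/
theorem norm_coeff_le_norm_trigPoly (q : AddMonoidAlgebra ℂ ℝ) (ν : ℝ) :
    ‖q.coeff ν‖ ≤ ‖trigPoly q‖ := by
  classical
  by_cases hν : ν ∈ q.coeff.support
  swap
  · rw [Finsupp.notMem_support_iff.1 hν]; simp
  set S := q.coeff.support.erase ν with hS
  set C : ℝ := ∑ μ ∈ S, ‖q.coeff μ‖ * (2 / |μ - ν|) with hC
  have key : ∀ T : ℝ, 0 < T → ‖q.coeff ν‖ * T ≤ ‖trigPoly q‖ * T + C := by
    intro T hT
    have hI : ∫ t in (0 : ℝ)..T, trigPoly q t * Complex.exp (-(Complex.I * ν * t)) =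
        q.coeff ν * T + ∑ μ ∈ S, q.coeff μ *
          ∫ t in (0 : ℝ)..T, Complex.exp (Complex.I * ((μ - ν : ℝ) : ℂ) * t) := by
      have h1 : ∀ t : ℝ, trigPoly q t * Complex.exp (-(Complex.I * ν * t)) =
          q.coeff ν + ∑ μ ∈ S, q.coeff μ *
            Complex.exp (Complex.I * ((μ - ν : ℝ) : ℂ) * t) := by
        intro t
        rw [trigPoly_apply, ← Finset.add_sum_erase _ _ hν, add_mul, mul_assoc, ← Complex.exp_add,
          add_neg_cancel, Complex.exp_zero, mul_one, Finset.sum_mul]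
        congr 1
        refine Finset.sum_congr rfl fun μ _ => ?_
        rw [mul_assoc, ← Complex.exp_add]
        push_cast
        ring_nf
      have hint : ∀ μ : ℝ, IntervalIntegrable
          (fun t : ℝ => q.coeff μ * Complex.exp (Complex.I * ((μ - ν : ℝ) : ℂ) * t))
          MeasureTheory.volume 0 T :=
        fun μ => Continuous.intervalIntegrable (by fun_prop) _ _
      simp_rw [h1]
      rw [intervalIntegral.integral_add (by simp)
        (Continuous.intervalIntegrable (by fun_prop) _ _),
        intervalIntegral.integral_finsetSum fun μ _ => hint μ]
      simp [mul_comm]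
    have hle : ‖∫ t in (0 : ℝ)..T, trigPoly q t * Complex.exp (-(Complex.I * ν * t))‖ ≤
        ‖trigPoly q‖ * T := by
      have := intervalIntegral.norm_integral_le_of_norm_le_const (a := 0) (b := T)
        (f := fun t : ℝ => trigPoly q t * Complex.exp (-(Complex.I * ν * t)))
        (C := ‖trigPoly q‖) (fun t _ => by
          have h2 : -(Complex.I * (ν : ℂ) * t) = ((-(ν * t) : ℝ) : ℂ) * Complex.I := by
            push_cast; ring
          rw [norm_mul, h2, Complex.norm_exp_ofReal_mul_I, mul_one]
          exact BoundedContinuousFunction.norm_coe_le_norm _ _)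
      simpa [abs_of_pos hT] using this
    have hsum : ‖∑ μ ∈ S, q.coeff μ *
        ∫ t in (0 : ℝ)..T, Complex.exp (Complex.I * ((μ - ν : ℝ) : ℂ) * t)‖ ≤ C := by
      refine (norm_sum_le _ _).trans (Finset.sum_le_sum fun μ hμ => ?_)
      rw [norm_mul]
      gcongr
      exact norm_integral_exp_le (sub_ne_zero.2 (Finset.ne_of_mem_erase hμ)) T
    have h3 := norm_sub_le (∫ t in (0 : ℝ)..T, trigPoly q t * Complex.exp (-(Complex.I * ν * t)))
      (∑ μ ∈ S, q.coeff μ * ∫ t in (0 : ℝ)..T, Complex.exp (Complex.I * ((μ - ν : ℝ) : ℂ) * t))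
    rw [hI, add_sub_cancel_right, ← hI, norm_mul, Complex.norm_of_nonneg hT.le] at h3
    linarith
  by_contra! hlt
  have hC0 : 0 ≤ C := Finset.sum_nonneg fun μ _ => by positivity
  have hd : 0 < ‖q.coeff ν‖ - ‖trigPoly q‖ := sub_pos.2 hlt
  have := key ((C + 1) / (‖q.coeff ν‖ - ‖trigPoly q‖)) (by positivity)
  have h4 : (‖q.coeff ν‖ - ‖trigPoly q‖) * ((C + 1) / (‖q.coeff ν‖ - ‖trigPoly q‖)) = C + 1 := by
    field_simp
  linarith

/-- Exponents of `q ^ p` are combinations of those of `q` with multiplicities at most `p`; the point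
is polynomial growth in `p`. -/
theorem AddMonoidAlgebra.card_support_pow_le {R M : Type*} [Semiring R] [AddCommMonoid M]
    (q : AddMonoidAlgebra R M) (p : ℕ) :
    (q ^ p).coeff.support.card ≤ (p + 1) ^ q.coeff.support.card := by
  classical
  have hsub : ∀ p : ℕ, (q ^ p).coeff.support ⊆
      (Fintype.piFinset fun _ : q.coeff.support => Finset.range (p + 1)).image
        fun α => ∑ s : q.coeff.support, α s • (s : M) := by
    intro p
    induction p with
    | zero =>
      intro x hx
      rw [pow_zero, AddMonoidAlgebra.one_def, AddMonoidAlgebra.coeff_single] at hx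
      have hx0 := Finsupp.support_single_subset hx
      simp only [Finset.mem_singleton] at hx0
      simp [hx0]
    | succ p ih =>
      intro x hx
      rw [pow_succ] at hx
      obtain ⟨y, hy, s, hs, rfl⟩ :=
        Finset.mem_add.1 (AddMonoidAlgebra.support_coeff_mul_subset _ _ hx)
      obtain ⟨α, hα, rfl⟩ := Finset.mem_image.1 (ih hy)
      refine Finset.mem_image.2 ⟨α + Pi.single ⟨s, hs⟩ 1, ?_, ?_⟩
      · simp only [Fintype.mem_piFinset, Finset.mem_range] at hα ⊢
        intro a
        have := hα a
        simp only [Pi.add_apply, Pi.single_apply]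
        split_ifs <;> omega
      · simp [add_smul, Finset.sum_add_distrib, Pi.single_apply, ite_smul]
  refine (Finset.card_le_card (hsub p)).trans (Finset.card_image_le.trans ?_)
  simp

/-- Every unitary character of the discrete group `ℝ` is contractive on trigonometric polynomials
with the supremum norm. -/
theorem norm_lift_le_norm_trigPoly {χ : Multiplicative ℝ →* ℂ} (hχ : ∀ μ, ‖χ μ‖ = 1)
    (q : AddMonoidAlgebra ℂ ℝ) : ‖AddMonoidAlgebra.lift ℂ ℂ ℝ χ q‖ ≤ ‖trigPoly q‖ := by
  set a := ‖AddMonoidAlgebra.lift ℂ ℂ ℝ χ q‖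
  set b := ‖trigPoly q‖
  set n := q.coeff.support.card
  -- Power trick: the crude coefficient bound for `q ^ p` loses only a polynomial factor in `p`,
  -- which cannot offset `(a / b) ^ p` if `a > b`.
  have key : ∀ p : ℕ, a ^ p ≤ ((p : ℝ) + 1) ^ n * b ^ p := by
    intro p
    calc a ^ p = ‖AddMonoidAlgebra.lift ℂ ℂ ℝ χ (q ^ p)‖ := by rw [map_pow, norm_pow]
      _ ≤ ∑ ν ∈ (q ^ p).coeff.support, ‖(q ^ p).coeff ν‖ := by
        rw [AddMonoidAlgebra.lift_apply]
        refine (norm_sum_le _ _).trans (Finset.sum_le_sum fun ν _ => ?_)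
        rw [norm_smul, hχ, mul_one]
      _ ≤ ∑ ν ∈ (q ^ p).coeff.support, b ^ p := by
        refine Finset.sum_le_sum fun ν _ => (norm_coeff_le_norm_trigPoly _ _).trans ?_
        rw [map_pow]
        exact norm_pow_le _ _
      _ = ((q ^ p).coeff.support.card : ℝ) * b ^ p := by simp
      _ ≤ ((p : ℝ) + 1) ^ n * b ^ p := by
        gcongr
        exact_mod_cast q.card_support_pow_le p
  by_contra! hlt
  have hb : 0 ≤ b := norm_nonneg _
  have ha : 0 < a := hb.trans_lt hlt
  have hlim := tendsto_pow_const_mul_const_pow_of_lt_one n (div_nonneg hb ha.le)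
    ((div_lt_one ha).2 hlt)
  obtain ⟨p, hp, hp1⟩ := ((hlim.eventually_lt_const
    (show (0 : ℝ) < (2 ^ n)⁻¹ by positivity)).and (Filter.eventually_ge_atTop 1)).exists
  have h1 : ((p : ℝ) + 1) ^ n ≤ 2 ^ n * (p : ℝ) ^ n := by
    rw [← mul_pow]
    gcongr
    have : (1 : ℝ) ≤ p := by exact_mod_cast hp1
    linarith
  rw [div_pow, mul_div_assoc', div_lt_iff₀ (by positivity), lt_inv_mul_iff₀ (by positivity),
    ← mul_assoc] at hp
  have h2 := key p
  have h3 : ((p : ℝ) + 1) ^ n * b ^ p ≤ 2 ^ n * (p : ℝ) ^ n * b ^ p := by gcongr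
  linarith

/-! ### The homomorphism induced by a family of characters, as a closed graph -/

/-- The unitary characters of the discrete group `ℝ` attached to a continuous family of additive
functions `ℝ → ℝ`. -/
noncomputable def twistHom {X : Type*} [TopologicalSpace X] (φ : ℝ →+ C(X, ℝ)) :
    Multiplicative ℝ →* (X →ᵇ ℂ) where
  toFun μ := BoundedContinuousFunction.ofNormedAddCommGroup
    (fun x => Complex.exp ((φ μ.toAdd x : ℝ) * Complex.I)) (by fun_prop) 1
    (fun x => by rw [Complex.norm_exp_ofReal_mul_I])
  map_one' := by ext x; simp
  map_mul' a b := by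
    ext x
    simp [add_mul, Complex.exp_add]

theorem twistHom_apply {X : Type*} [TopologicalSpace X] (φ : ℝ →+ C(X, ℝ))
    (μ : Multiplicative ℝ) (x : X) :
    twistHom φ μ x = Complex.exp ((φ μ.toAdd x : ℝ) * Complex.I) := rfl

/-- The twisted evaluation of formal trigonometric polynomials. -/
noncomputable def twistPoly {X : Type*} [TopologicalSpace X] (φ : ℝ →+ C(X, ℝ)) :
    AddMonoidAlgebra ℂ ℝ →ₐ[ℂ] (X →ᵇ ℂ) :=
  AddMonoidAlgebra.lift ℂ (X →ᵇ ℂ) ℝ (twistHom φ)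

theorem twistPoly_single {X : Type*} [TopologicalSpace X] (φ : ℝ →+ C(X, ℝ)) (μ : ℝ) (a : ℂ) :
    twistPoly φ (AddMonoidAlgebra.single μ a) = a • twistHom φ (Multiplicative.ofAdd μ) := by
  rw [twistPoly, AddMonoidAlgebra.lift_single]

theorem norm_twistPoly_le {X : Type*} [TopologicalSpace X] (φ : ℝ →+ C(X, ℝ))
    (q : AddMonoidAlgebra ℂ ℝ) : ‖twistPoly φ q‖ ≤ ‖trigPoly q‖ := by
  refine (BoundedContinuousFunction.norm_le (norm_nonneg _)).2 fun x => ?_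
  let χ : Multiplicative ℝ →* ℂ :=
    { toFun := fun μ => twistHom φ μ x
      map_one' := by simp
      map_mul' := by simp }
  have hχ : ∀ μ, ‖χ μ‖ = 1 := fun μ => Complex.norm_exp_ofReal_mul_I _
  have h1 : twistPoly φ q x = AddMonoidAlgebra.lift ℂ ℂ ℝ χ q := by
    rw [twistPoly, AddMonoidAlgebra.lift_apply, AddMonoidAlgebra.lift_apply]
    simp [Finsupp.sum, χ]
  rw [h1]
  exact norm_lift_le_norm_trigPoly hχ q

/-- The closure of the graph of `trigPoly q ↦ twistPoly φ q`. -/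
noncomputable def twistGraph {X : Type*} [TopologicalSpace X] (φ : ℝ →+ C(X, ℝ)) :
    Subalgebra ℂ ((ℝ →ᵇ ℂ) × (X →ᵇ ℂ)) :=
  ((trigPoly.prod (twistPoly φ)).range).topologicalClosure

/-- The contraction estimate passes to the closure; hence the graph is single-valued. -/
theorem norm_snd_le_of_mem_twistGraph {X : Type*} [TopologicalSpace X] {φ : ℝ →+ C(X, ℝ)}
    {z : (ℝ →ᵇ ℂ) × (X →ᵇ ℂ)} (hz : z ∈ twistGraph φ) : ‖z.2‖ ≤ ‖z.1‖ := by
  have hcl : IsClosed {z : (ℝ →ᵇ ℂ) × (X →ᵇ ℂ) | ‖z.2‖ ≤ ‖z.1‖} :=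
    isClosed_le (by fun_prop) (by fun_prop)
  refine closure_minimal ?_ hcl hz
  rintro _ ⟨q, rfl⟩
  exact norm_twistPoly_le φ q

theorem genTrigPolys_subset_range : genTrigPolys ⊆ Set.range trigPoly := by
  rintro _ ⟨n, a, μ, rfl⟩
  exact ⟨∑ j, AddMonoidAlgebra.single (μ j) (a j), by simp [map_sum, trigPoly_single]⟩

theorem expChar_twist_mem_twistGraph {X : Type*} [TopologicalSpace X] (φ : ℝ →+ C(X, ℝ)) (μ : ℝ) :
    (expChar μ, twistHom φ (Multiplicative.ofAdd μ)) ∈ twistGraph φ :=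
  subset_closure ⟨AddMonoidAlgebra.single μ 1, by
    simp [trigPoly_single, twistPoly_single]⟩

/-- The first projection of the complete space `twistGraph φ` is antilipschitz, so its range is
closed, and it contains the trigonometric polynomials. -/
theorem exists_mem_twistGraph {X : Type*} [TopologicalSpace X] (φ : ℝ →+ C(X, ℝ))
    {f : ℝ →ᵇ ℂ} (hf : f ∈ AP) : ∃ g, (f, g) ∈ twistGraph φ := by
  have hanti : AntilipschitzWith 1 (fun z : twistGraph φ => z.1.1) := by
    refine AntilipschitzWith.of_le_mul_dist fun x y => ?_
    have h := norm_snd_le_of_mem_twistGraph (sub_mem x.2 y.2)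
    rw [NNReal.coe_one, one_mul, Subtype.dist_eq, Prod.dist_eq, dist_eq_norm, dist_eq_norm]
    exact max_le le_rfl h
  have hcomp : CompleteSpace (twistGraph φ) :=
    (Subalgebra.isClosed_topologicalClosure _).completeSpace_coe
  have hcl : IsClosed (Set.range fun z : twistGraph φ => z.1.1) :=
    hanti.isClosed_range (LipschitzWith.prod_fst.comp (LipschitzWith.subtype_val _)).uniformContinuous
  have hsub : genTrigPolys ⊆ Set.range fun z : twistGraph φ => z.1.1 := by
    intro f hf
    obtain ⟨q, rfl⟩ := genTrigPolys_subset_range hf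
    exact ⟨⟨(trigPoly q, twistPoly φ q), subset_closure ⟨q, rfl⟩⟩, rfl⟩
  obtain ⟨z, rfl⟩ := closure_minimal hsub hcl hf
  exact ⟨z.1.2, z.2⟩

/-! ### Prescribing the images of the `F_j` -/

/-- Every family of angles, continuous in a parameter, can be prescribed on a sequence of
rationally independent frequencies. -/
theorem exists_addMonoidHom_apply_eq {X : Type*} [TopologicalSpace X] {lam : ℕ → ℝ}
    (hlam : LinearIndependent ℚ lam) (θ : ℕ → C(X, ℝ)) :
    ∃ φ : ℝ →+ C(X, ℝ), ∀ k, φ (lam k) = θ k := by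
  let b := Module.Basis.span hlam
  -- The `ℚ`-linear map fixed by `θ` on the span of the frequencies extends to all of `ℝ`.
  obtain ⟨g, hg⟩ := LinearMap.exists_extend (b.constr ℚ θ)
  refine ⟨g.toAddMonoidHom, fun k => ?_⟩
  have h1 := DFunLike.congr_fun hg (b k)
  rw [b.constr_basis, LinearMap.comp_apply] at h1
  rw [← h1]
  simp [b, Module.Basis.span_apply]

/-- The points `1 + c` with `‖c‖ ≤ 1 / 2` are sums of two unimodular numbers, continuously
in `c`. -/
theorem exists_angles {X : Type*} [TopologicalSpace X] (c : C(X, ℂ)) (hc : ∀ x, ‖c x‖ ≤ 1 / 2) :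
    ∃ α β : C(X, ℝ), ∀ x, Complex.exp ((α x : ℝ) * Complex.I) +
      Complex.exp ((β x : ℝ) * Complex.I) = 1 + c x := by
  have hslit : ∀ x, 1 + c x ∈ Complex.slitPlane := fun x => by
    left
    have := (abs_le.1 ((Complex.abs_re_le_norm (c x)).trans (hc x))).1
    simp only [Complex.add_re, Complex.one_re]
    linarith
  have hle : ∀ x, ‖1 + c x‖ ≤ 2 := fun x => by
    have := norm_add_le 1 (c x)
    rw [norm_one] at this
    linarith [hc x]
  have harg : Continuous fun x => Complex.arg (1 + c x) :=
    continuous_iff_continuousAt.2 fun x =>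
      (Complex.continuousAt_arg (hslit x)).comp (f := fun x => 1 + c x) (by fun_prop)
  have hacos : Continuous fun x => Real.arccos (‖1 + c x‖ / 2) :=
    Real.continuous_arccos.comp (by fun_prop)
  -- The two unit vectors lie symmetrically about the direction of `1 + c x`, at angle `arccos (‖1 +
  -- c x‖ / 2)`.
  refine ⟨⟨_, harg.add hacos⟩, ⟨_, harg.sub hacos⟩, fun x => ?_⟩
  have hcos : Complex.exp ((Real.arccos (‖1 + c x‖ / 2) : ℝ) * Complex.I) +
      Complex.exp (-((Real.arccos (‖1 + c x‖ / 2) : ℝ) * Complex.I)) = ‖1 + c x‖ := by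
    have h1 := Complex.two_cos (Real.arccos (‖1 + c x‖ / 2) : ℂ)
    rw [← Complex.ofReal_cos, Real.cos_arccos (by linarith [norm_nonneg (1 + c x)])
      (by linarith [hle x])] at h1
    rw [← neg_mul, ← h1]
    push_cast
    ring
  have h2 := Complex.norm_mul_exp_arg_mul_I (1 + c x)
  simp only [ContinuousMap.coe_mk, Pi.add_apply, Pi.sub_apply]
  push_cast
  rw [add_mul, sub_mul, Complex.exp_add, sub_eq_add_neg, Complex.exp_add, ← mul_add, hcos, mul_comm,
    h2]

theorem exists_twistGraph_pairFun {X : Type*} [TopologicalSpace X] {lam : ℕ → ℝ}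
    (hlam : LinearIndependent ℚ lam) (c : ℕ → C(X, ℂ)) (hc : ∀ j x, ‖c j x‖ ≤ 1 / 2) :
    ∃ φ : ℝ →+ C(X, ℝ), ∀ j, ∃ g : X →ᵇ ℂ, (∀ x, g x = c j x) ∧ (pairFun lam j, g) ∈ twistGraph φ := by
  choose α β h using fun j => exists_angles (c j) (hc j)
  obtain ⟨φ, hφ⟩ := exists_addMonoidHom_apply_eq hlam
    (fun k => if k % 2 = 0 then α (k / 2) else β (k / 2))
  refine ⟨φ, fun j => ⟨_, fun x => ?_, sub_mem (add_mem (expChar_twist_mem_twistGraph φ (lam (2 * j)))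
    (expChar_twist_mem_twistGraph φ (lam (2 * j + 1)))) (one_mem _)⟩⟩
  have h0 : (2 * j + 1) / 2 = j := by omega
  have h1 : (2 * j + 1) % 2 = 1 := by omega
  have e0 : φ (lam (2 * j)) = α j := by rw [hφ]; simp
  have e1 : φ (lam (2 * j + 1)) = β j := by rw [hφ]; simp [h0, h1]
  simp [twistHom_apply, e0, e1, h j x]

theorem pairFun_mem_AP (lam : ℕ → ℝ) (j : ℕ) : pairFun lam j ∈ AP := by
  refine subset_closure ⟨3, ![1, 1, -1], ![lam (2 * j), lam (2 * j + 1), 0], ?_⟩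
  ext t
  simp [Fin.sum_univ_three, pairFun, expChar_apply, sub_eq_add_neg]

/-- The graph is a subalgebra, so it contains the image of the Bézout defect; its first component is
zero, hence so is the second. -/
theorem IsInvertibleTuple.exists_apply_ne_zero {X : Type*} [TopologicalSpace X] {φ : ℝ →+ C(X, ℝ)}
    {A : Subalgebra ℂ (ℝ →ᵇ ℂ)} (hA : (A : Set (ℝ →ᵇ ℂ)) ⊆ AP) {n : ℕ} {f : Fin n → A}
    (hf : IsInvertibleTuple f) {g : Fin n → X →ᵇ ℂ}
    (hg : ∀ j, ((f j : ℝ →ᵇ ℂ), g j) ∈ twistGraph φ) (x : X) : ∃ j, g j x ≠ 0 := by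
  obtain ⟨y, hy⟩ := hf
  choose z hz using fun j => exists_mem_twistGraph φ (hA (y j).2)
  by_contra! h0
  have hmem := sub_mem (sum_mem (t := Finset.univ) fun j _ => mul_mem (hz j) (hg j))
    (one_mem (twistGraph φ))
  have h1 := norm_snd_le_of_mem_twistGraph hmem
  have h2 : ∑ j, ((y j : ℝ →ᵇ ℂ)) * (f j : ℝ →ᵇ ℂ) = 1 := by
    have := congrArg (Subtype.val : A → ℝ →ᵇ ℂ) hy
    simpa using this
  simp only [Prod.fst_sub, Prod.snd_sub, Prod.fst_sum, Prod.snd_sum, Prod.mk_mul_mk, Prod.fst_one,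
    Prod.snd_one, h2, sub_self, norm_zero] at h1
  have h3 := DFunLike.congr_fun (norm_le_zero_iff.1 h1) x
  simp [h0] at h3

theorem exists_clipped_coordinates (N : ℕ) : ∃ c : ℕ → C(EuclideanSpace ℂ (Fin N), ℂ),
    (∀ j u, ‖c j u‖ ≤ 1 / 2) ∧ ∀ u, ‖u‖ ≤ 1 / 2 → ∀ j : Fin N,
      c j u = u j ∧ c (N + j) u = star (u j) := by
  -- Radial retraction of the plane onto the disc of radius `1/2`.
  let κ : C(ℂ, ℂ) := ⟨fun z => ((max 1 (2 * ‖z‖))⁻¹ : ℝ) • z,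
    ((continuous_const.max (continuous_const.mul continuous_norm)).inv₀
      fun z => (zero_lt_one.trans_le (le_max_left _ _)).ne').smul continuous_id⟩
  have hκ : ∀ z, ‖κ z‖ ≤ 1 / 2 := fun z => by
    have hpos : 0 < max 1 (2 * ‖z‖) := zero_lt_one.trans_le (le_max_left _ _)
    simp only [κ, ContinuousMap.coe_mk, norm_smul, norm_inv, Real.norm_of_nonneg hpos.le]
    rw [inv_mul_le_iff₀ hpos]
    linarith [le_max_right 1 (2 * ‖z‖)]
  have hκid : ∀ z, ‖z‖ ≤ 1 / 2 → κ z = z := fun z hz => by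
    have : max 1 (2 * ‖z‖) = 1 := max_eq_left (by linarith)
    simp [κ, this]
  let π : Fin N → C(EuclideanSpace ℂ (Fin N), ℂ) := fun j => ⟨fun u => u j, by fun_prop⟩
  refine ⟨fun k => if h : k < N then κ.comp (π ⟨k, h⟩) else
    if h : k - N < N then star (κ.comp (π ⟨k - N, h⟩)) else 0, fun k u => ?_, fun u hu j => ?_⟩
  · dsimp only
    split_ifs
    · exact hκ _
    · rw [ContinuousMap.star_apply, norm_star]; exact hκ _
    · simp
  · have hj : κ (u j) = u j := hκid _ ((PiLp.norm_apply_le u j).trans hu)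
    simp [π, hj]

/-! ### The two assertions of the theorem -/

theorem exists_le_norm_pairFun_sub {lam : ℕ → ℝ} (hlam : LinearIndependent ℚ lam)
    {A : Subalgebra ℂ (ℝ →ᵇ ℂ)} (hA : (A : Set (ℝ →ᵇ ℂ)) ⊆ AP) {N : ℕ} (hN : 1 ≤ N)
    (H : Fin N → A) (hH : IsInvertibleTuple H) :
    ∃ j : Fin N, 1 / (4 * N : ℝ) ≤ ‖pairFun lam j - (H j : ℝ →ᵇ ℂ)‖ := by
  by_contra! hlt
  obtain ⟨c, hc, hcu⟩ := exists_clipped_coordinates N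
  obtain ⟨φ, hφ⟩ := exists_twistGraph_pairFun hlam c hc
  choose G hGc hG using hφ
  choose K hK using fun j => exists_mem_twistGraph φ (hA (H j).2)
  have hdist : ∀ (j : Fin N) u, ‖K j u - G j u‖ ≤ 1 / (4 * N : ℝ) := by
    intro j u
    have h1 := norm_snd_le_of_mem_twistGraph (sub_mem (hG j) (hK j))
    have h2 := (G j - K j).norm_coe_le_norm u
    rw [norm_sub_rev]
    exact h2.trans (h1.trans (hlt j).le)
  -- Cutoff equal to `1` for `‖u‖ ≤ 1/2` and to `0` for `‖u‖ ≥ 1`. As `‖w u‖ ≤ 1/2`, a zero of `u +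
  -- w u` lies where `τ u = 1`.
  let τ : EuclideanSpace ℂ (Fin N) → ℝ := fun u => min 1 (max 0 (2 - 2 * ‖u‖))
  have hτ : Continuous τ := by fun_prop
  have hτ0 : ∀ u, 0 ≤ τ u := fun u => le_min zero_le_one (le_max_left _ _)
  have hτ1 : ∀ u, τ u ≤ 1 := fun u => min_le_left _ _
  let w : EuclideanSpace ℂ (Fin N) → EuclideanSpace ℂ (Fin N) := fun u =>
    WithLp.toLp 2 fun j => (τ u : ℂ) * (K j u - G j u)
  have hw : Continuous w := by
    refine (PiLp.continuous_toLp 2 _).comp (continuous_pi fun j => ?_)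
    exact (Complex.continuous_ofReal.comp hτ).mul ((K j).continuous.sub (G j).continuous)
  obtain ⟨u, hu⟩ := exists_add_eq_zero_of_eq_zero_of_le_norm hw one_pos (fun u hu => by
    have : τ u = 0 := by
      simp only [τ]
      rw [max_eq_left (by linarith), min_eq_right zero_le_one]
    ext j
    simp [w, this])
  have hwu : ‖w u‖ ≤ 1 / 2 := by
    have hNR : (1 : ℝ) ≤ N := by exact_mod_cast hN
    refine abs_le_of_sq_le_sq' ?_ (by norm_num) |>.2
    rw [EuclideanSpace.norm_sq_eq]
    calc ∑ j, ‖w u j‖ ^ 2 ≤ ∑ j : Fin N, (1 / (4 * N : ℝ)) ^ 2 := by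
          refine Finset.sum_le_sum fun j _ => ?_
          gcongr
          simp only [w, norm_mul, Complex.norm_real, Real.norm_of_nonneg (hτ0 u)]
          exact (mul_le_of_le_one_left (norm_nonneg _) (hτ1 u)).trans (hdist j u)
      _ = 1 / (16 * N) := by
          simp only [Finset.sum_const, Finset.card_univ, Fintype.card_fin, nsmul_eq_mul]
          field_simp
          norm_num
      _ ≤ (1 / 2) ^ 2 := by
          rw [div_le_iff₀ (by positivity)]
          linarith
  have hun : ‖u‖ ≤ 1 / 2 := by
    rwa [eq_neg_of_add_eq_zero_left hu, norm_neg]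
  have hτu : τ u = 1 := min_eq_left (le_max_of_le_right (by linarith))
  obtain ⟨j, hj⟩ := hH.exists_apply_ne_zero hA hK u
  apply hj
  have := congrArg (fun v : EuclideanSpace ℂ (Fin N) => v j) hu
  simpa [w, hτu, hGc, (hcu u hun j).1] using this

theorem exists_isInvertibleTuple_not_isReducibleTuple {lam : ℕ → ℝ}
    (hlam : LinearIndependent ℚ lam) {A : Subalgebra ℂ (ℝ →ᵇ ℂ)}
    (hA : (A : Set (ℝ →ᵇ ℂ)) ⊆ AP) (hF : ∀ j, pairFun lam j ∈ A) (n : ℕ) :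
    ∃ f : Fin (n + 1) → A, IsInvertibleTuple f ∧ ¬ IsReducibleTuple f := by
  let F : ℕ → A := fun j => ⟨pairFun lam j, hF j⟩
  -- Chosen so that `∑ 4 F_{n+j} F_j + g = 1`, while the image of `g` is `1 - 4‖u‖²` on the ball of
  -- radius `1/2`, vanishing on its boundary.
  let g : A := 1 - 4 * ∑ j : Fin n, F (n + j) * F j
  refine ⟨Fin.snoc (α := fun _ => A) (fun j : Fin n => F j) g,
    ⟨Fin.snoc (α := fun _ => A) (fun j : Fin n => 4 * F (n + j)) 1, ?_⟩, ?_⟩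
  · simp only [Fin.sum_univ_castSucc, Fin.snoc_castSucc, Fin.snoc_last, g, Finset.mul_sum,
      mul_assoc, one_mul]
    ring
  rintro ⟨a, ha⟩
  simp only [Fin.snoc_castSucc, Fin.snoc_last] at ha
  obtain ⟨c, hc, hcu⟩ := exists_clipped_coordinates n
  obtain ⟨φ, hφ⟩ := exists_twistGraph_pairFun hlam c hc
  choose G hGc hG using hφ
  choose b hb using fun j => exists_mem_twistGraph φ (hA (a j).2)
  let g' : EuclideanSpace ℂ (Fin n) →ᵇ ℂ := 1 - 4 * ∑ j : Fin n, G (n + j) * G j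
  have hgg : ((g : ℝ →ᵇ ℂ), g') ∈ twistGraph φ := by
    have h := sub_mem (one_mem (twistGraph φ)) (mul_mem (ofNat_mem (twistGraph φ) 4)
      (sum_mem (t := Finset.univ) fun (j : Fin n) _ => mul_mem (hG (n + j)) (hG j)))
    convert h using 1
    ext1
    · simp [g, F, Prod.fst_sum]
      rfl
    · simp [g', Prod.snd_sum]
  have hg' : ∀ u, ‖u‖ ≤ 1 / 2 → g' u = ((1 - 4 * ‖u‖ ^ 2 : ℝ) : ℂ) := by
    intro u hu
    have h1 : ∀ j : Fin n, G (n + j) u * G j u = ((‖u j‖ ^ 2 : ℝ) : ℂ) := fun j => by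
      rw [hGc, hGc, (hcu u hu j).1, (hcu u hu j).2, Complex.star_def, mul_comm, Complex.mul_conj,
        Complex.normSq_eq_norm_sq]
    rw [EuclideanSpace.norm_sq_eq]
    simp [g', h1]
  -- The image of `a_j g` inside the ball of radius `1/2`, continued by zero outside.
  let w : EuclideanSpace ℂ (Fin n) → EuclideanSpace ℂ (Fin n) := fun u =>
    WithLp.toLp 2 fun j => b j u * ((max 0 (1 - 4 * ‖u‖ ^ 2) : ℝ) : ℂ)
  have hw : Continuous w := by
    refine (PiLp.continuous_toLp 2 _).comp (continuous_pi fun j => ?_)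
    exact (b j).continuous.mul (Complex.continuous_ofReal.comp (by fun_prop))
  have hw0 : ∀ u, 1 / 2 ≤ ‖u‖ → w u = 0 := fun u hu => by
    have : max 0 (1 - 4 * ‖u‖ ^ 2) = 0 := max_eq_left (by nlinarith)
    ext j
    simp only [w, this]
    simp
  obtain ⟨u, hu⟩ := exists_add_eq_zero_of_eq_zero_of_le_norm hw (by norm_num) hw0
  have hun : ‖u‖ ≤ 1 / 2 := by
    by_contra! hlt
    rw [hw0 u hlt.le, add_zero] at hu
    rw [hu, norm_zero] at hlt
    norm_num at hlt
  have hmax : max 0 (1 - 4 * ‖u‖ ^ 2) = 1 - 4 * ‖u‖ ^ 2 :=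
    max_eq_right (by nlinarith [norm_nonneg u])
  obtain ⟨j, hj⟩ := ha.exists_apply_ne_zero hA
    (g := fun j => G j + b j * g') (fun j => add_mem (hG j) (mul_mem (hb j) hgg)) u
  apply hj
  have h1 := congrArg (fun v : EuclideanSpace ℂ (Fin n) => v j) hu
  simp only [w, hmax, ← hg' u hun] at h1
  simpa [hGc, (hcu u hun j).1] using h1

theorem mainTheorem2 (lam : ℕ → ℝ) (hlam : LinearIndependent ℚ lam) :
    (∀ j : ℕ, pairFun lam j ∈ AP) ∧
    ∀ A : Subalgebra ℂ (ℝ →ᵇ ℂ), (A : Set (ℝ →ᵇ ℂ)) ⊆ AP → (∀ j : ℕ, pairFun lam j ∈ A) →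
      bassStableRank A = ⊤ ∧
      ∀ N : ℕ, 1 ≤ N →
        ∃ ε : ℝ, 0 < ε ∧ ∀ H : Fin N → A, IsInvertibleTuple H →
          ∃ j : Fin N, ε ≤ ‖pairFun lam j - (H j : ℝ →ᵇ ℂ)‖ := by
  refine ⟨pairFun_mem_AP lam, fun A hA hF => ⟨?_, fun N hN => ?_⟩⟩
  · refine iInf₂_eq_top.2 fun n hn => ?_
    obtain ⟨f, hf, hf'⟩ := exists_isInvertibleTuple_not_isReducibleTuple hlam hA hF n
    exact absurd (hn.2 f hf) hf'
  · have : (0 : ℝ) < N := by exact_mod_cast hN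
    exact ⟨1 / (4 * N), by positivity, exists_le_norm_pairFun_sub hlam hA hN⟩
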